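/- Let $n\ge 0$ be an integer and let $\beta\ge 2$ be real. For real $\alpha\ge\beta$ put $W_{\alpha,\beta}(x)=\frac{|x|^\alpha}{\alpha}-\frac{|x|^\beta}{\beta}$ for $x\in\mathbf R^n$, where $|\cdot|$ is the Euclidean norm, and for a Borel probability measure $\mu$ on $\mathbf R^n$ let $$\mathcal E_{W_{\alpha,\beta}}(\mu)=\iint_{\mathbf R^n\times\mathbf R^n}W_{\alpha,\beta}(x-y)\,d\mu(x)\,d\mu(y)\in(-\infty,+\infty].$$ Then there is a constant $A=A(n,\beta)\in\mathbf R$ such that for every $\alpha\in[\beta,\infty)$ with $\alpha\ge A$ and every Borel probability measure $\mu$ on $\mathbf R^n$ the following are equivalent: (i) $\mu$ minimizes $\mathcal E_{W_{\alpha,\beta}}$, i.e. $\mathcal E_{W_{\alpha,\beta}}(\mu)\le\mathcal E_{W_{\alpha,\beta}}(\nu)$ for every Borel probability measure $\nu$ on $\mathbf R^n$; (ii) $\mu$ is uniformly distributed over the vertices of a unit $n$-simplex, i.e. there are points $x_0,\dots,x_n\in\mathbf R^n$ with $|x_i-x_j|=1$ for all $0\le i<j\le n$ such that $\mu=\frac1{n+1}\sum_{i=0}^n\delta_{x_i}$.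 -/

import Mathlib

open MeasureTheory
open scoped ENNReal

/-- The power-law pair potential `W_{α,β}(x) = |x|^α / α - |x|^β / β` on Euclidean `ℝⁿ`. -/
noncomputable def powerLawPotential {n : ℕ} (α β : ℝ) (x : EuclideanSpace ℝ (Fin n)) : ℝ :=
  ‖x‖ ^ α / α - ‖x‖ ^ β / β

/-- The interaction energy `∬ W(x - y) dμ(x) dμ(y)`, as an extended real number: the Lebesgue
integral of the positive part minus that of the negative part. For a potential that is bounded
below (such as the power-law potentials with `α ≥ β > 0`) and a probability measure, the second
integral is finite, so that the energy is a well-defined element of `(-∞, +∞]`. -/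
noncomputable def interactionEnergy {n : ℕ} (W : EuclideanSpace ℝ (Fin n) → ℝ)
    (μ : Measure (EuclideanSpace ℝ (Fin n))) : EReal :=
  ((∫⁻ p, ENNReal.ofReal (W (p.1 - p.2)) ∂(μ.prod μ) : ℝ≥0∞) : EReal)
    - ((∫⁻ p, ENNReal.ofReal (-W (p.1 - p.2)) ∂(μ.prod μ) : ℝ≥0∞) : EReal)

/-- `μ` minimizes the interaction energy among all Borel probability measures on `ℝⁿ`. -/
def IsEnergyMinimizer {n : ℕ} (W : EuclideanSpace ℝ (Fin n) → ℝ)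
    (μ : Measure (EuclideanSpace ℝ (Fin n))) : Prop :=
  IsProbabilityMeasure μ ∧
    ∀ ν : Measure (EuclideanSpace ℝ (Fin n)), IsProbabilityMeasure ν →
      interactionEnergy W μ ≤ interactionEnergy W ν

/-- The points `x 0, …, x k` of `ℝⁿ` are the vertices of a unit `k`-simplex: all their mutual
distances are equal to `1`. -/
def IsUnitSimplexVertices {n k : ℕ} (x : Fin (k + 1) → EuclideanSpace ℝ (Fin n)) : Prop :=
  ∀ i j, i < j → dist (x i) (x j) = 1

/-- `μ` is uniformly distributed over the vertices of some unit `n`-simplex in `ℝⁿ`: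
it is the sum of point masses `1 / (n + 1)` at the vertices. -/
def IsUniformOnUnitSimplexVertices {n : ℕ} (μ : Measure (EuclideanSpace ℝ (Fin n))) : Prop :=
  ∃ x : Fin (n + 1) → EuclideanSpace ℝ (Fin n), IsUnitSimplexVertices x ∧
    μ = ∑ i, ((n : ℝ≥0∞) + 1)⁻¹ • Measure.dirac (x i)

/-! Put c = 1/β − 1/α. For β ≥ 2 and α > max(4, β) the potential dominates c(r⁴ − 2r²), with
equality only at r = 0 and r = 1 (`quartic_lt_powerLaw`). The energy of r⁴ − 2r² is a polynomial in
moments of μ, and a sum of squares bounds it below by −n/(n+1) (`quartic_energy_bound`). A unit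
simplex involves only the distances 0 and 1 and attains −c·n/(n+1), so it minimizes.

Conversely, a minimizer has equality in both bounds. Almost all distances are then 0 or 1, so the
mean square distance to x is 1 − μ{x}; it is also n/(n+1) for almost every x. Hence μ consists of
n+1 equal atoms at mutual distance 1 (`isUniformOnUnitSimplexVertices_of_dist`). -/

/-! ### Pointwise comparison with the quartic potential -/

/-- With p = 2/s and L = 2 log r the function is 2rˢ/s, so convexity in p compares powers of r with
different exponents. -/
theorem strictConvexOn_mul_exp_div {L : ℝ} (hL : L ≠ 0) :
    StrictConvexOn ℝ (Set.Ioi 0) fun p : ℝ => p * Real.exp (L / p) := by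
  refine ⟨convex_Ioi 0, fun x hx y hy hxy a b ha hb hab => ?_⟩
  simp only [Set.mem_Ioi, smul_eq_mul] at *
  set q := a * x + b * y with hq
  have hq0 : 0 < q := by positivity
  -- The left side is the tangent line at q; the claim reduces to t + 1 < eᵗ at t = L/p − L/q.
  have tangent : ∀ p, 0 < p → p ≠ q →
      Real.exp (L / q) * (p + L - L * p / q) < p * Real.exp (L / p) := by
    intro p hp hpq
    have hne : L / p - L / q ≠ 0 := by
      intro h
      apply hpq
      rw [sub_eq_zero, div_eq_div_iff hp.ne' hq0.ne'] at h
      exact (mul_left_cancel₀ hL h).symm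
    have h1 := Real.add_one_lt_exp hne
    have h2 : Real.exp (L / p) = Real.exp (L / q) * Real.exp (L / p - L / q) := by
      rw [← Real.exp_add]; congr 1; ring
    have h3 : p + L - L * p / q = p * (L / p - L / q + 1) := by
      field_simp
      ring
    rw [h2, h3]
    have := Real.exp_pos (L / q)
    calc _ < Real.exp (L / q) * (p * Real.exp (L / p - L / q)) := by gcongr
      _ = _ := by ring
  have hxq : x ≠ q := by
    intro h
    apply hxy
    have : b * (x - y) = 0 := by
      have : x = a * x + b * y := h
      linear_combination this + x * hab
    rcases mul_eq_zero.1 this with h | h <;> linarith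
  have hyq : y ≠ q := by
    intro h
    apply hxy
    have : a * (y - x) = 0 := by
      have : y = a * x + b * y := h
      linear_combination this + y * hab
    rcases mul_eq_zero.1 this with h | h <;> linarith
  have h1 := mul_lt_mul_of_pos_left (tangent x hx hxq) ha
  have h2 := mul_lt_mul_of_pos_left (tangent y hy hyq) hb
  have h3 : q * Real.exp (L / q) = a * (Real.exp (L / q) * (x + L - L * x / q))
      + b * (Real.exp (L / q) * (y + L - L * y / q)) := by
    have : L * q / q = L := by field_simp
    have e : L * (a * x + b * y) / q = L := by rw [← hq]; exact this
    have : q = a * x + b * y + (a + b) * L - L * (a * x + b * y) / q := by rw [e, hab]; linarith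
    calc q * Real.exp (L / q)
        = (a * x + b * y + (a + b) * L - L * (a * x + b * y) / q) * Real.exp (L / q) := by
          rw [← this]
      _ = _ := by ring
  linarith

/-- Power-law potentials lie strictly above the normalized potential with exponents `4` and `2`,
except at distances `0` and `1`. -/
theorem quartic_lt_powerLaw {α β r : ℝ} (hβ : 2 ≤ β) (hα : 4 < α) (hβα : β < α)
    (hr : 0 < r) (hr1 : r ≠ 1) :
    (1 / β - 1 / α) * (r ^ 4 - 2 * r ^ 2) < r ^ α / α - r ^ β / β := by
  have hL : 2 * Real.log r ≠ 0 := by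
    simpa using ⟨hr.ne', hr1, by linarith⟩
  have hG := strictConvexOn_mul_exp_div hL
  have hβ0 : 0 < β := by linarith
  have hα0 : 0 < α := by linarith
  have hpow : ∀ s : ℝ, 0 < s → 2 / s * Real.exp (2 * Real.log r / (2 / s)) = 2 * (r ^ s / s) := by
    intro s hs
    rw [Real.rpow_def_of_pos hr]
    have : 2 * Real.log r / (2 / s) = Real.log r * s := by field_simp
    rw [this]; ring
  have hpq : 2 / α < 2 / β := by gcongr
  have hq1 : 2 / β ≤ 1 := by rw [div_le_one hβ0]; exact hβ
  have hp : 2 / α < 1 / 2 := by rw [div_lt_div_iff₀ hα0 two_pos]; linarith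
  have hp0 : 0 < 2 / α := by positivity
  have hq0 : 0 < 2 / β := by positivity
  -- Secant slopes increase along the intervals [2/α, 2/β], [2/α, 1], [1/2, 1], the last step
  -- strictly; this is where β ≥ 2 and α > 4 enter.
  have s1 := hG.convexOn.secant_mono (a := 2 / α) (x := 2 / β) (y := 1) hp0 hq0
    (Set.mem_Ioi.2 one_pos) hpq.ne' (by linarith) hq1
  have s2 := hG.secant_strict_mono (a := 1) (x := 2 / α) (y := 1 / 2) (Set.mem_Ioi.2 one_pos) hp0
    (by norm_num) (by linarith) (by norm_num) hp
  have e1 : (1 : ℝ) * Real.exp (2 * Real.log r / 1) = r ^ 2 := by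
    rw [one_mul, div_one, mul_comm, ← Real.rpow_def_of_pos hr]
    exact_mod_cast Real.rpow_natCast r 2
  have e2 : (1 / 2 : ℝ) * Real.exp (2 * Real.log r / (1 / 2)) = r ^ 4 / 2 := by
    have : 2 * Real.log r / (1 / 2) = Real.log r * 4 := by ring
    rw [this, ← Real.rpow_def_of_pos hr]
    have : r ^ (4 : ℝ) = r ^ 4 := by exact_mod_cast Real.rpow_natCast r 4
    rw [this]; ring
  rw [hpow α hα0, hpow β hβ0, e1] at s1
  rw [hpow α hα0, e1, e2] at s2
  rw [← neg_div_neg_eq, neg_sub, neg_sub] at s2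
  have s3 := s1.trans_lt s2
  rw [div_lt_iff₀ (by linarith)] at s3
  have : (r ^ 4 / 2 - r ^ 2) / (1 / 2 - 1) = 2 * r ^ 2 - r ^ 4 := by ring
  rw [this] at s3
  have : 2 / β - 2 / α = 2 * (1 / β - 1 / α) := by ring
  rw [this] at s3
  linarith

/-! ### Calculus of integrals with known values -/

/-- The integral of `f` exists and equals `a`. -/
def HasIntegral {Ω : Type*} [MeasurableSpace Ω] (μ : Measure Ω) (f : Ω → ℝ) (a : ℝ) : Prop :=
  Integrable f μ ∧ ∫ x, f x ∂μ = a

namespace HasIntegral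

variable {Ω : Type*} [MeasurableSpace Ω] {μ : Measure Ω} {f g : Ω → ℝ} {a b : ℝ}

theorem of_integrable (hf : Integrable f μ) : HasIntegral μ f (∫ x, f x ∂μ) := ⟨hf, rfl⟩

theorem add (hf : HasIntegral μ f a) (hg : HasIntegral μ g b) :
    HasIntegral μ (fun x => f x + g x) (a + b) :=
  ⟨hf.1.add hg.1, by rw [integral_add hf.1 hg.1, hf.2, hg.2]⟩

theorem sub (hf : HasIntegral μ f a) (hg : HasIntegral μ g b) :
    HasIntegral μ (fun x => f x - g x) (a - b) :=
  ⟨hf.1.sub hg.1, by rw [integral_sub hf.1 hg.1, hf.2, hg.2]⟩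

theorem const_mul (c : ℝ) (hf : HasIntegral μ f a) :
    HasIntegral μ (fun x => c * f x) (c * a) :=
  ⟨hf.1.const_mul c, by rw [integral_const_mul, hf.2]⟩

theorem sum {ι : Type*} [Fintype ι] {F : ι → Ω → ℝ} {A : ι → ℝ}
    (h : ∀ i, HasIntegral μ (F i) (A i)) :
    HasIntegral μ (fun x => ∑ i, F i x) (∑ i, A i) :=
  ⟨integrable_finsetSum _ fun i _ => (h i).1, by
    rw [integral_finsetSum _ fun i _ => (h i).1]
    exact Finset.sum_congr rfl fun i _ => (h i).2⟩

theorem const [IsProbabilityMeasure μ] (c : ℝ) : HasIntegral μ (fun _ => c) c :=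
  ⟨integrable_const c, by simp⟩

theorem prod_mul [SFinite μ] (hf : HasIntegral μ f a) (hg : HasIntegral μ g b) :
    HasIntegral (μ.prod μ) (fun p => f p.1 * g p.2) (a * b) :=
  ⟨hf.1.mul_prod hg.1, by rw [integral_prod_mul, hf.2, hg.2]⟩

theorem fst [IsProbabilityMeasure μ] (hf : HasIntegral μ f a) :
    HasIntegral (μ.prod μ) (fun p => f p.1) a := by
  simpa using hf.prod_mul (const 1)

theorem snd [IsProbabilityMeasure μ] (hf : HasIntegral μ f a) :
    HasIntegral (μ.prod μ) (fun p => f p.2) a := by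
  simpa using (const 1).prod_mul hf

end HasIntegral

/-! ### Moments and the quartic energy -/

section Moments

variable {n : ℕ} {μ : Measure (EuclideanSpace ℝ (Fin n))}

/-- Fubini gives one centre w with a finite fourth moment; the triangle inequality moves it to z. -/
theorem integrable_norm_sub_pow_four [IsProbabilityMeasure μ]
    (h : Integrable (fun p : EuclideanSpace ℝ (Fin n) × EuclideanSpace ℝ (Fin n) =>
      ‖p.1 - p.2‖ ^ 4) (μ.prod μ)) (z : EuclideanSpace ℝ (Fin n)) :
    Integrable (fun x => ‖x - z‖ ^ 4) μ := by
  obtain ⟨w, hw⟩ := h.prod_right_ae.exists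
  refine ((hw.const_mul 8).add (integrable_const (8 * ‖w - z‖ ^ 4))).mono'
    (by fun_prop) (.of_forall fun x => ?_)
  rw [Real.norm_of_nonneg (by positivity)]
  have h1 : ‖x - z‖ ≤ ‖w - x‖ + ‖w - z‖ := by
    rw [norm_sub_rev w x]
    simpa using norm_add_le (x - w) (w - z)
  calc ‖x - z‖ ^ 4 ≤ (‖w - x‖ + ‖w - z‖) ^ 4 := by gcongr
    _ ≤ 8 * ‖w - x‖ ^ 4 + 8 * ‖w - z‖ ^ 4 := by
      have := add_pow_le (norm_nonneg (w - x)) (norm_nonneg (w - z)) 4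
      norm_num at this
      linarith

/-- Functions of at most quartic growth are integrable. -/
theorem integrable_of_abs_le_one_add_pow_four [IsProbabilityMeasure μ]
    {z : EuclideanSpace ℝ (Fin n)} (h : Integrable (fun x => ‖x - z‖ ^ 4) μ)
    {f : EuclideanSpace ℝ (Fin n) → ℝ} (hf : Continuous f)
    (hfz : ∀ x, |f x| ≤ 1 + ‖x - z‖ ^ 4) : Integrable f μ :=
  ((integrable_const 1).add h).mono' hf.aestronglyMeasurable (.of_forall hfz)

/-- Among probability measures, the interaction energy of `|x|⁴ - 2|x|²` is at least
`-n / (n + 1)`, and in the case of equality the mean square distance to almost every point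
is `n / (n + 1)`. -/
theorem quartic_energy_bound [IsProbabilityMeasure μ]
    (h : Integrable (fun p : EuclideanSpace ℝ (Fin n) × EuclideanSpace ℝ (Fin n) =>
      ‖p.1 - p.2‖ ^ 4) (μ.prod μ)) :
    ∃ M : ℝ, HasIntegral (μ.prod μ) (fun p => ‖p.1 - p.2‖ ^ 4 - 2 * ‖p.1 - p.2‖ ^ 2) M ∧
      0 ≤ (n + 1) * M + n ∧
      ((n + 1) * M + n = 0 →
        ∀ᵐ x ∂μ, HasIntegral μ (fun y => ‖x - y‖ ^ 2) (n / (n + 1))) := by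
  have h0 := integrable_norm_sub_pow_four h 0
  have hcoord : ∀ i, Integrable (fun x : EuclideanSpace ℝ (Fin n) => x i) μ := fun i =>
    integrable_of_abs_le_one_add_pow_four h0 (by fun_prop) fun x => by
      have := PiLp.norm_apply_le x i
      rw [Real.norm_eq_abs] at this
      rw [sub_zero]
      nlinarith [sq_nonneg (‖x‖ ^ 2 - 1 / 2), sq_nonneg (‖x‖ - 1 / 2)]
  -- Centring at the barycentre kills every term linear in one of the variables.
  set z : EuclideanSpace ℝ (Fin n) := WithLp.toLp 2 fun i => ∫ x, x i ∂μ with hz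
  have hN4 := integrable_norm_sub_pow_four h z
  have habs : ∀ x i, |(x - z) i| ≤ ‖x - z‖ := fun x i => by
    simpa only [Real.norm_eq_abs] using PiLp.norm_apply_le (x - z) i
  have hu : ∀ i, HasIntegral μ (fun x => (x - z) i) 0 := fun i => by
    have := (HasIntegral.of_integrable (hcoord i)).sub (HasIntegral.const (z i))
    simpa [hz] using this
  have hS : ∀ i j, HasIntegral μ (fun x => (x - z) i * (x - z) j)
      (∫ x, (x - z) i * (x - z) j ∂μ) := fun i j => .of_integrable <|
    integrable_of_abs_le_one_add_pow_four hN4 (by fun_prop) fun x => by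
      rw [abs_mul]
      have := mul_le_mul (habs x i) (habs x j) (abs_nonneg _) (norm_nonneg _)
      nlinarith [sq_nonneg (‖x - z‖ ^ 2 - 1 / 2)]
  have hT : ∀ i, HasIntegral μ (fun x => (x - z) i * ‖x - z‖ ^ 2)
      (∫ x, (x - z) i * ‖x - z‖ ^ 2 ∂μ) := fun i => .of_integrable <|
    integrable_of_abs_le_one_add_pow_four hN4 (by fun_prop) fun x => by
      rw [abs_mul, abs_of_nonneg (sq_nonneg ‖x - z‖)]
      have := mul_le_mul_of_nonneg_right (habs x i) (sq_nonneg ‖x - z‖)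
      nlinarith [sq_nonneg (‖x - z‖ ^ 2 - ‖x - z‖), sq_nonneg (‖x - z‖ ^ 2 - 1 / 2)]
  set S : Fin n → Fin n → ℝ := fun i j => ∫ x, (x - z) i * (x - z) j ∂μ with hSdef
  set T : Fin n → ℝ := fun i => ∫ x, (x - z) i * ‖x - z‖ ^ 2 ∂μ
  set m : ℝ := ∑ i, S i i with hm
  set Q : ℝ := ∑ i, ∑ j, S i j * S i j with hQ
  set M4 : ℝ := ∫ x, ‖x - z‖ ^ 4 ∂μ
  have hnorm : ∀ x : EuclideanSpace ℝ (Fin n), ‖x‖ ^ 2 = ∑ i, x i * x i := fun x => by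
    rw [EuclideanSpace.norm_sq_eq]
    exact Finset.sum_congr rfl fun i _ => by rw [Real.norm_eq_abs, sq_abs, sq]
  have hN2 : HasIntegral μ (fun x => ‖x - z‖ ^ 2) m := by
    simpa only [hnorm] using HasIntegral.sum fun i => hS i i
  have hN4' : HasIntegral μ (fun x => ‖x - z‖ ^ 4) M4 := .of_integrable hN4
  have hsq : ∀ x y : EuclideanSpace ℝ (Fin n),
      ‖x - y‖ ^ 2 = ‖x - z‖ ^ 2 + ‖y - z‖ ^ 2 - 2 * ∑ i, (x - z) i * (y - z) i := fun x y => by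
    simp only [hnorm, Finset.mul_sum, ← Finset.sum_add_distrib, ← Finset.sum_sub_distrib]
    refine Finset.sum_congr rfl fun i _ => ?_
    simp only [PiLp.sub_apply]
    ring
  -- Squaring `hsq` gives a sum of products of a function of x and a function of y. Here m and Q are
  -- the trace and the squared Frobenius norm of the covariance S.
  have hM : HasIntegral (μ.prod μ) (fun p => ‖p.1 - p.2‖ ^ 4 - 2 * ‖p.1 - p.2‖ ^ 2)
      (2 * M4 + 2 * m ^ 2 + 4 * Q - 4 * m) := by
    have hU : HasIntegral (μ.prod μ)
        (fun p => ∑ i, (p.1 - z) i * (p.2 - z) i) (∑ _i : Fin n, 0 * 0) :=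
      .sum fun i => (hu i).prod_mul (hu i)
    have hUU : HasIntegral (μ.prod μ) (fun p => ∑ i, ∑ j,
        ((p.1 - z) i * (p.1 - z) j) * ((p.2 - z) i * (p.2 - z) j)) Q :=
      .sum fun i => .sum fun j => (hS i j).prod_mul (hS i j)
    have hV : HasIntegral (μ.prod μ) (fun p => ∑ i, ((p.1 - z) i * ‖p.1 - z‖ ^ 2) * (p.2 - z) i)
        (∑ i, T i * 0) := .sum fun i => (hT i).prod_mul (hu i)
    have hW : HasIntegral (μ.prod μ) (fun p => ∑ i, (p.1 - z) i * ((p.2 - z) i * ‖p.2 - z‖ ^ 2))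
        (∑ i, 0 * T i) := .sum fun i => (hu i).prod_mul (hT i)
    have key := (((((((hN4'.fst.add hN4'.snd).add ((hN2.prod_mul hN2).const_mul 2)).add
      (hUU.const_mul 4)).sub (hV.const_mul 4)).sub (hW.const_mul 4)).sub
      (hN2.fst.const_mul 2)).sub (hN2.snd.const_mul 2)).add (hU.const_mul 4)
    convert key using 1
    · funext ⟨x, y⟩
      have e1 : ‖x - y‖ ^ 4 = (‖x - y‖ ^ 2) ^ 2 := by ring
      have e2 : ∑ i, ∑ j, ((x - z) i * (x - z) j) * ((y - z) i * (y - z) j)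
          = (∑ i, (x - z) i * (y - z) i) ^ 2 := by
        rw [sq, Finset.sum_mul_sum]
        refine Finset.sum_congr rfl fun i _ => Finset.sum_congr rfl fun j _ => by ring
      have e3 : ∑ i, ((x - z) i * ‖x - z‖ ^ 2) * (y - z) i
          = ‖x - z‖ ^ 2 * ∑ i, (x - z) i * (y - z) i := by
        rw [Finset.mul_sum]
        refine Finset.sum_congr rfl fun i _ => by ring
      have e4 : ∑ i, (x - z) i * ((y - z) i * ‖y - z‖ ^ 2)
          = ‖y - z‖ ^ 2 * ∑ i, (x - z) i * (y - z) i := by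
        rw [Finset.mul_sum]
        refine Finset.sum_congr rfl fun i _ => by ring
      dsimp only
      rw [e1, e2, e3, e4, hsq x y]
      ring
    · simp only [mul_zero, zero_mul, Finset.sum_const_zero]
      ring
  have hvar : HasIntegral μ (fun x => (‖x - z‖ ^ 2 - m) ^ 2) (M4 - m ^ 2) := by
    have key := (hN4'.sub (hN2.const_mul (2 * m))).add (HasIntegral.const (m ^ 2))
    convert key using 1
    · funext x; ring
    · ring
  have hM4 : 0 ≤ M4 - m ^ 2 := by
    rw [← hvar.2]
    exact integral_nonneg fun x => sq_nonneg _
  -- Cauchy–Schwarz on the diagonal of S, dropping the off-diagonal squares.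
  have hQ0 : 0 ≤ n * Q - m ^ 2 := by
    have h1 : m ^ 2 ≤ n * ∑ i, S i i ^ 2 := by
      simpa using sq_sum_le_card_mul_sum_sq (s := Finset.univ) (f := fun i => S i i)
    have h2 : ∑ i, S i i ^ 2 ≤ Q := Finset.sum_le_sum fun i _ => by
      rw [sq]
      exact Finset.single_le_sum (f := fun j => S i j * S i j)
        (fun j _ => mul_self_nonneg _) (Finset.mem_univ i)
    nlinarith [Nat.cast_nonneg (α := ℝ) n]
  have hQnn : 0 ≤ Q :=
    Finset.sum_nonneg fun i _ => Finset.sum_nonneg fun j _ => mul_self_nonneg _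
  set M := 2 * M4 + 2 * m ^ 2 + 4 * Q - 4 * m with hMdef
  -- The sum-of-squares certificate. The factor n makes it void for n = 0, which is treated
  -- separately.
  have hid : n * ((n + 1) * M + n)
      = (n + 1) * (2 * n * (M4 - m ^ 2) + 4 * (n * Q - m ^ 2)) + (2 * (n + 1) * m - n) ^ 2 := by
    rw [hMdef]; ring
  have hmean : ∀ x, HasIntegral μ (fun y => ‖x - y‖ ^ 2) (‖x - z‖ ^ 2 + m) := fun x => by
    have key := ((HasIntegral.const (μ := μ) (‖x - z‖ ^ 2)).add hN2).sub
      ((HasIntegral.sum fun i => (hu i).const_mul ((x - z) i)).const_mul 2)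
    convert key using 1
    · funext y; exact hsq x y
    · simp
  have hconcl : M4 - m ^ 2 = 0 → 2 * (n + 1) * m = n →
      ∀ᵐ x ∂μ, HasIntegral μ (fun y => ‖x - y‖ ^ 2) (n / (n + 1)) := by
    intro h1 h2
    have h3 := hvar.2
    rw [h1, integral_eq_zero_iff_of_nonneg (fun x => sq_nonneg _) hvar.1] at h3
    filter_upwards [h3] with x hx
    have h4 : ‖x - z‖ ^ 2 = m := by
      have : (‖x - z‖ ^ 2 - m) ^ 2 = 0 := hx
      linarith [pow_eq_zero_iff two_ne_zero |>.1 this]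
    have h5 := hmean x
    have h6 : ‖x - z‖ ^ 2 + m = n / (n + 1) := by
      rw [h4, eq_div_iff (by positivity)]
      linarith
    rwa [h6] at h5
  rcases Nat.eq_zero_or_pos n with hn | hn
  · have hn' : (n : ℝ) = 0 := by exact_mod_cast hn
    have hm0 : m = 0 := by
      have : m ^ 2 ≤ 0 := by rw [hn'] at hQ0; linarith
      nlinarith
    have hMe : (n + 1) * M + n = 2 * M4 + 4 * Q := by rw [hMdef, hn', hm0]; ring
    rw [hm0] at hM4 hconcl
    refine ⟨M, hM, by rw [hMe]; nlinarith, fun he => hconcl ?_ (by simp [hn'])⟩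
    rw [hMe] at he
    nlinarith
  · have hn' : (0 : ℝ) < n := by exact_mod_cast hn
    have t1 : 0 ≤ 2 * n * (M4 - m ^ 2) := by positivity
    have t2 : 0 ≤ (n + 1) * (2 * n * (M4 - m ^ 2) + 4 * (n * Q - m ^ 2)) := by positivity
    have t3 := sq_nonneg (2 * (n + 1) * m - n)
    refine ⟨M, hM, nonneg_of_mul_nonneg_right (by rw [hid]; positivity) hn', fun he => ?_⟩
    rw [he, mul_zero] at hid
    have t4 : (2 * (n + 1) * m - n) ^ 2 = 0 := by linarith
    have t5 : (n + 1 : ℝ) * (2 * n * (M4 - m ^ 2) + 4 * (n * Q - m ^ 2)) = 0 := by linarith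
    refine hconcl ?_ (by linarith [pow_eq_zero_iff two_ne_zero |>.1 t4])
    have t6 : 2 * n * (M4 - m ^ 2) + 4 * (n * Q - m ^ 2) = 0 :=
      (mul_eq_zero.1 t5).resolve_left (by positivity)
    have t7 : 2 * n * (M4 - m ^ 2) = 0 := by linarith
    exact (mul_eq_zero.1 t7).resolve_left (by positivity)

end Moments

/-! ### From the equality case to the simplex -/

variable {n : ℕ}

/-- A probability measure all of whose distances are `0` or `1`, and whose mean square distance
to almost every point is `n / (n + 1)`, is uniform on the vertices of a unit simplex. -/
theorem isUniformOnUnitSimplexVertices_of_dist {μ : Measure (EuclideanSpace ℝ (Fin n))}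
    [IsProbabilityMeasure μ]
    (hdist : ∀ᵐ p ∂μ.prod μ, ‖p.1 - p.2‖ = 0 ∨ ‖p.1 - p.2‖ = 1)
    (hmean : ∀ᵐ x ∂μ, HasIntegral μ (fun y => ‖x - y‖ ^ 2) (n / (n + 1))) :
    IsUniformOnUnitSimplexVertices μ := by
  set T : Set (EuclideanSpace ℝ (Fin n)) := {x | μ {x} = ((n : ℝ≥0∞) + 1)⁻¹}
  have hc0 : ((n : ℝ≥0∞) + 1)⁻¹ ≠ 0 := by simp
  have hcinv : ((n : ℝ≥0∞) + 1)⁻¹ * ((n : ℝ≥0∞) + 1) = 1 :=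
    ENNReal.inv_mul_cancel (by simp) (by finiteness)
  have hT : ∀ᵐ x ∂μ, x ∈ T := by
    filter_upwards [hmean, Measure.ae_ae_of_ae_prod hdist] with x hx hx'
    -- As distances are 0 or 1, the squared distance to x is the indicator of y ≠ x.
    have h1 : ∫ y, ‖x - y‖ ^ 2 ∂μ = ∫ y, ({x}ᶜ : Set _).indicator 1 y ∂μ := by
      refine integral_congr_ae ?_
      filter_upwards [hx'] with y hy
      by_cases hyx : y = x
      · simp [hyx]
      · have : ‖x - y‖ = 1 := hy.resolve_left (by simpa [sub_eq_zero] using Ne.symm hyx)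
        simp [hyx, this]
    rw [hx.2, integral_indicator_one (measurableSet_singleton x).compl,
      probReal_compl_eq_one_sub (measurableSet_singleton x)] at h1
    have h2 : μ.real {x} = ((n : ℝ) + 1)⁻¹ := by
      have : (n : ℝ) / (n + 1) = 1 - ((n : ℝ) + 1)⁻¹ := by field_simp; ring
      linarith
    change μ {x} = _
    rw [← ofReal_measureReal, h2, ENNReal.ofReal_inv_of_pos (by positivity),
      ENNReal.ofReal_add (by positivity) zero_le_one]
    simp
  have hfin_meas : ∀ s : Finset (EuclideanSpace ℝ (Fin n)), (s : Set _) ⊆ T →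
      μ s = s.card * ((n : ℝ≥0∞) + 1)⁻¹ := fun s hs => by
    rw [← sum_measure_singleton, Finset.sum_congr rfl fun x hx => (hs hx : μ {x} = _)]
    simp
  have hTfin : T.Finite := by
    by_contra hinf
    obtain ⟨s, hsT, hs⟩ := Set.Infinite.exists_subset_card_eq hinf (n + 2)
    have h1 : μ s ≤ 1 := prob_le_one
    rw [hfin_meas s hsT, hs] at h1
    have h2 : (1 : ℝ≥0∞) < ((n + 2 : ℕ) : ℝ≥0∞) * ((n : ℝ≥0∞) + 1)⁻¹ := by
      rw [← ENNReal.div_eq_inv_mul.trans (mul_comm _ _), ENNReal.lt_div_iff_mul_lt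
        (by simp) (by simp), one_mul]
      exact_mod_cast Nat.lt_succ_self (n + 1)
    exact h1.not_gt h2
  obtain ⟨s, hs⟩ := hTfin.exists_finset_coe
  have hs1 : μ s = 1 := by
    rw [hs]; exact prob_compl_eq_zero_iff hTfin.measurableSet |>.1 hT
  have hcard : s.card = n + 1 := by
    rw [hfin_meas s hs.subset] at hs1
    have : (s.card : ℝ≥0∞) = n + 1 :=
      calc (s.card : ℝ≥0∞) = s.card * (((n : ℝ≥0∞) + 1)⁻¹ * (n + 1)) := by rw [hcinv, mul_one]
        _ = n + 1 := by rw [← mul_assoc, hs1, one_mul]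
    exact_mod_cast this
  let e := s.equivFinOfCardEq hcard
  refine ⟨fun i => e.symm i, fun i j hij => ?_, ?_⟩
  · have hpos : ∀ k, μ {(e.symm k : EuclideanSpace ℝ (Fin n))} ≠ 0 := fun k => by
      have : (e.symm k : EuclideanSpace ℝ (Fin n)) ∈ T := hs ▸ (e.symm k).2
      rw [show μ {(e.symm k : EuclideanSpace ℝ (Fin n))} = _ from this]
      exact hc0
    have hd : ‖(e.symm i : EuclideanSpace ℝ (Fin n)) - e.symm j‖ = 0 ∨
        ‖(e.symm i : EuclideanSpace ℝ (Fin n)) - e.symm j‖ = 1 := by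
      by_contra hne
      -- A pair of atoms has positive product mass, so it cannot lie in the exceptional null set.
      have h0 : (μ.prod μ) ({(e.symm i : EuclideanSpace ℝ (Fin n))} ×ˢ
          {(e.symm j : EuclideanSpace ℝ (Fin n))}) = 0 :=
        measure_mono_null (by rintro ⟨x, y⟩ ⟨rfl, rfl⟩; exact hne) hdist
      rw [Measure.prod_prod] at h0
      exact (mul_ne_zero (hpos i) (hpos j)) h0
    rw [dist_eq_norm]
    refine hd.resolve_left fun h => ?_
    rw [norm_eq_zero, sub_eq_zero] at h
    exact hij.ne (e.symm.injective (Subtype.ext h))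
  · ext A hA
    rw [← measure_inter_conull (t := (s : Set _)) (by rw [hs]; exact hT)]
    classical
    have h1 : A ∩ s = ((s.filter (· ∈ A) : Finset _) : Set _) := by ext; simp [and_comm]
    rw [h1, ← sum_measure_singleton, Finset.sum_filter, Measure.finsetSum_apply,
      ← Finset.sum_coe_sort s, ← e.symm.sum_comp]
    refine Finset.sum_congr rfl fun i _ => ?_
    have hi : (e.symm i : EuclideanSpace ℝ (Fin n)) ∈ T := hs ▸ (e.symm i).2
    rw [show μ {(e.symm i : EuclideanSpace ℝ (Fin n))} = _ from hi, Measure.smul_apply,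
      Measure.dirac_apply' _ hA]
    by_cases h : (e.symm i : EuclideanSpace ℝ (Fin n)) ∈ A <;> simp [h]

/-! ### Existence of a unit simplex -/

/-- There is a unit `n`-simplex in `ℝⁿ`. -/
theorem exists_isUnitSimplexVertices (n : ℕ) :
    ∃ x : Fin (n + 1) → EuclideanSpace ℝ (Fin n), IsUnitSimplexVertices x := by
  set a : ℝ := (√2)⁻¹
  -- The vertices are a·eᵢ and b(1,…,1), where b solves nb² − 2ab + a² = 1; this rationalized root
  -- also makes sense for n = 0.
  set b : ℝ := -(√2 * (1 + √(n + 1)))⁻¹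
  have ha : a ^ 2 = 1 / 2 := by simp [a]
  have hab : (n : ℝ) * b ^ 2 - 2 * a * b + a ^ 2 = 1 := by
    have h1 : √((n : ℝ) + 1) ^ 2 = n + 1 := Real.sq_sqrt (by positivity)
    have h2 : √(2 : ℝ) ^ 2 = 2 := Real.sq_sqrt (by positivity)
    have h3 : b = -(a * (1 + √(n + 1))⁻¹) := by simp only [a, b, mul_inv]
    set t := √((n : ℝ) + 1)
    have h4 : (n : ℝ) = (t - 1) * (t + 1) := by linarith
    have ht : 0 ≤ t := Real.sqrt_nonneg _
    have h5 : (1 + t) ≠ 0 := by positivity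
    rw [h3, h4]
    have : (t - 1) * (t + 1) * (-(a * (1 + t)⁻¹)) ^ 2 - 2 * a * -(a * (1 + t)⁻¹) + a ^ 2
        = 2 * a ^ 2 := by
      field_simp
      ring
    rw [this, ha]; norm_num
  let v : Fin n → EuclideanSpace ℝ (Fin n) := fun i => EuclideanSpace.single i a
  let w : EuclideanSpace ℝ (Fin n) := WithLp.toLp 2 fun _ => b
  have hvv : ∀ i j, i ≠ j → dist (v i) (v j) = 1 := fun i j hij => by
    rw [EuclideanSpace.dist_eq, Real.sqrt_eq_one, Finset.sum_eq_add i j hij]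
    · simp [v, hij, hij.symm, Real.dist_eq, ha]; norm_num
    · intro k _ hk
      simp [v, hk.1, hk.2]
    · simp
    · simp
  have hvw : ∀ i, dist (v i) w = 1 := fun i => by
    rw [EuclideanSpace.dist_eq, Real.sqrt_eq_one]
    have : ∀ j, dist ((v i) j) (w j) ^ 2 = b ^ 2 + if j = i then a ^ 2 - 2 * a * b else 0 := by
      intro j
      rw [Real.dist_eq, sq_abs]
      by_cases h : j = i
      · simp [v, w, h]; ring
      · simp [v, w, h]
    simp only [this, Finset.sum_add_distrib, Finset.sum_ite_eq', Finset.mem_univ, if_true,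
      Finset.sum_const, Finset.card_univ, Fintype.card_fin, nsmul_eq_mul]
    linarith
  refine ⟨Fin.snoc v w, fun i j hij => ?_⟩
  induction i using Fin.lastCases with
  | last => exact absurd hij (Fin.le_last j).not_gt
  | cast i =>
    induction j using Fin.lastCases with
    | last => simpa using hvw i
    | cast j => simpa using hvv i j (by rintro rfl; exact hij.ne rfl)

/-! ### Energy of power-law potentials -/

section Energy

variable {α β : ℝ}

theorem continuous_powerLawPotential (hα : 0 ≤ α) (hβ : 0 ≤ β) :
    Continuous (powerLawPotential (n := n) α β) := by
  unfold powerLawPotential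
  exact ((continuous_norm.rpow_const fun _ => .inr hα).div_const _).sub
    ((continuous_norm.rpow_const fun _ => .inr hβ).div_const _)

theorem quartic_le_powerLawPotential (hβ : 2 ≤ β) (hα : 4 < α) (hβα : β < α)
    (x : EuclideanSpace ℝ (Fin n)) :
    (1 / β - 1 / α) * (‖x‖ ^ 4 - 2 * ‖x‖ ^ 2) ≤ powerLawPotential α β x ∧
      ((1 / β - 1 / α) * (‖x‖ ^ 4 - 2 * ‖x‖ ^ 2) = powerLawPotential α β x →
        ‖x‖ = 0 ∨ ‖x‖ = 1) := by
  have hα0 : α ≠ 0 := by linarith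
  have hβ0 : β ≠ 0 := by linarith
  unfold powerLawPotential
  rcases (norm_nonneg x).eq_or_lt with h0 | h0
  · simp [← h0, Real.zero_rpow hα0, Real.zero_rpow hβ0]
  by_cases h1 : ‖x‖ = 1
  · refine ⟨?_, fun _ => .inr h1⟩
    simp only [h1, Real.one_rpow]
    linarith
  · have := quartic_lt_powerLaw hβ hα hβα h0 h1
    exact ⟨this.le, fun h => absurd h this.ne⟩

theorem interactionEnergy_eq_integral {W : EuclideanSpace ℝ (Fin n) → ℝ}
    {μ : Measure (EuclideanSpace ℝ (Fin n))}
    (h : Integrable (fun p : _ × _ => W (p.1 - p.2)) (μ.prod μ)) :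
    interactionEnergy W μ = ((∫ p, W (p.1 - p.2) ∂μ.prod μ : ℝ) : EReal) := by
  rw [interactionEnergy, integral_eq_lintegral_pos_part_sub_lintegral_neg_part h, EReal.coe_sub,
    EReal.coe_ennreal_toReal h.lintegral_lt_top.ne,
    EReal.coe_ennreal_toReal (show ∫⁻ p, ENNReal.ofReal (-W (p.1 - p.2)) ∂μ.prod μ ≠ ⊤ from
      h.neg.lintegral_lt_top.ne)]

/-- Either the energy is infinite, or the potential and the fourth power of the distance are
integrable. -/
theorem interactionEnergy_eq_top_or_integrable (hβ : 2 ≤ β) (hα : 4 < α) (hβα : β < α)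
    (μ : Measure (EuclideanSpace ℝ (Fin n))) [IsProbabilityMeasure μ] :
    interactionEnergy (powerLawPotential α β) μ = ⊤ ∨
      Integrable (fun p : _ × _ => powerLawPotential α β (p.1 - p.2)) (μ.prod μ) ∧
      Integrable (fun p : EuclideanSpace ℝ (Fin n) × EuclideanSpace ℝ (Fin n) =>
        ‖p.1 - p.2‖ ^ 4) (μ.prod μ) := by
  have hc : 0 < 1 / β - 1 / α := sub_pos.2 (one_div_lt_one_div_of_lt (by linarith) hβα)
  set c := 1 / β - 1 / α
  have hlow := fun x : EuclideanSpace ℝ (Fin n) => (quartic_le_powerLawPotential hβ hα hβα x).1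
  have hneg : ∀ x : EuclideanSpace ℝ (Fin n), -powerLawPotential α β x ≤ c := fun x => by
    have := mul_nonneg hc.le (sq_nonneg (‖x‖ ^ 2 - 1))
    linarith [hlow x]
  have hcont : Continuous fun p : EuclideanSpace ℝ (Fin n) × EuclideanSpace ℝ (Fin n) =>
      powerLawPotential α β (p.1 - p.2) :=
    (continuous_powerLawPotential (by linarith) (by linarith)).comp (by fun_prop)
  have hnegfin : ∫⁻ p, ENNReal.ofReal (-powerLawPotential α β (p.1 - p.2)) ∂μ.prod μ < ⊤ := by
    refine lt_of_le_of_lt (lintegral_mono fun p => ENNReal.ofReal_le_ofReal (hneg _)) ?_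
    simp
  by_cases hpos : ∫⁻ p, ENNReal.ofReal (powerLawPotential α β (p.1 - p.2)) ∂μ.prod μ = ⊤
  · left
    rw [interactionEnergy, hpos, EReal.coe_ennreal_top]
    lift ∫⁻ p, ENNReal.ofReal (-powerLawPotential α β (p.1 - p.2)) ∂μ.prod μ to NNReal
      using hnegfin.ne with a
    exact EReal.top_sub_coe a
  right
  have hint : Integrable (fun p : _ × _ => powerLawPotential α β (p.1 - p.2)) (μ.prod μ) := by
    refine ⟨hcont.aestronglyMeasurable, ?_⟩
    rw [hasFiniteIntegral_iff_norm]
    refine lt_of_le_of_lt (lintegral_mono (g := fun p : _ × _ =>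
      ENNReal.ofReal (powerLawPotential α β (p.1 - p.2)) +
        ENNReal.ofReal (-powerLawPotential α β (p.1 - p.2))) fun p => ?_) ?_
    · rcases le_total 0 (powerLawPotential α β (p.1 - p.2)) with h | h
      · simp [abs_of_nonneg h]
      · simp [abs_of_nonpos h]
    · rw [lintegral_add_left hcont.measurable.ennreal_ofReal]
      exact ENNReal.add_lt_top.2 ⟨lt_top_iff_ne_top.2 hpos, hnegfin⟩
  -- The constants come from 2(r⁴ − 2r²) + 4 = r⁴ + (r² − 2)² ≥ r⁴.
  refine ⟨hint, ((hint.const_mul (2 / c)).add (integrable_const 4)).mono' (by fun_prop)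
    (.of_forall fun p => ?_)⟩
  rw [Real.norm_of_nonneg (by positivity)]
  have h1 := mul_le_mul_of_nonneg_left (hlow (p.1 - p.2)) (by positivity : 0 ≤ 2 / c)
  have h2 : 2 / c * (c * (‖p.1 - p.2‖ ^ 4 - 2 * ‖p.1 - p.2‖ ^ 2))
      = 2 * (‖p.1 - p.2‖ ^ 4 - 2 * ‖p.1 - p.2‖ ^ 2) := by field_simp
  simp only [Pi.add_apply]
  nlinarith [sq_nonneg (‖p.1 - p.2‖ ^ 2 - 2)]

theorem powerLaw_energy_bound (hβ : 2 ≤ β) (hα : 4 < α) (hβα : β < α)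
    (μ : Measure (EuclideanSpace ℝ (Fin n))) [IsProbabilityMeasure μ] :
    ((-((1 / β - 1 / α) * (n / (n + 1))) : ℝ) : EReal) ≤
        interactionEnergy (powerLawPotential α β) μ ∧
      (interactionEnergy (powerLawPotential α β) μ =
          ((-((1 / β - 1 / α) * (n / (n + 1))) : ℝ) : EReal) →
        IsUniformOnUnitSimplexVertices μ) := by
  rcases interactionEnergy_eq_top_or_integrable hβ hα hβα μ with h | ⟨hW, h4⟩
  · rw [h]
    exact ⟨le_top, fun h => absurd h.symm (EReal.coe_ne_top _)⟩
  have hc : 0 < 1 / β - 1 / α := sub_pos.2 (one_div_lt_one_div_of_lt (by linarith) hβα)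
  set c := 1 / β - 1 / α
  obtain ⟨M, hM, hM0, hMeq⟩ := quartic_energy_bound h4
  rw [interactionEnergy_eq_integral hW, EReal.coe_le_coe_iff, EReal.coe_eq_coe_iff]
  have hdiff := (HasIntegral.of_integrable hW).sub (hM.const_mul c)
  have hnn : ∀ p : EuclideanSpace ℝ (Fin n) × EuclideanSpace ℝ (Fin n),
      0 ≤ powerLawPotential α β (p.1 - p.2)
        - c * (‖p.1 - p.2‖ ^ 4 - 2 * ‖p.1 - p.2‖ ^ 2) := fun p =>
    sub_nonneg.2 (quartic_le_powerLawPotential hβ hα hβα (p.1 - p.2)).1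
  have h1 : c * M ≤ ∫ p, powerLawPotential α β (p.1 - p.2) ∂μ.prod μ := by
    rw [← sub_nonneg, ← hdiff.2]
    exact integral_nonneg hnn
  have hn1 : (0 : ℝ) < n + 1 := by positivity
  have h2 : M + n / (n + 1) = ((n + 1) * M + n) / (n + 1) := by field_simp
  have h3 : 0 ≤ M + n / (n + 1) := by rw [h2]; positivity
  have h4 := mul_nonneg hc.le h3
  refine ⟨by linarith, fun he => ?_⟩
  have h5 : c * (M + n / (n + 1)) = 0 := by linarith
  have h6 : M + n / (n + 1) = 0 := (mul_eq_zero.1 h5).resolve_left hc.ne'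
  refine isUniformOnUnitSimplexVertices_of_dist ?_ (hMeq ?_)
  · have h7 := hdiff.2
    rw [show ∫ p, powerLawPotential α β (p.1 - p.2) ∂μ.prod μ - c * M = 0 by linarith,
      integral_eq_zero_iff_of_nonneg hnn hdiff.1] at h7
    filter_upwards [h7] with p hp
    exact (quartic_le_powerLawPotential hβ hα hβα (p.1 - p.2)).2 (sub_eq_zero.1 hp).symm
  · rw [h2, div_eq_zero_iff] at h6
    exact h6.resolve_right hn1.ne'

theorem isProbabilityMeasure_sum_dirac (x : Fin (n + 1) → EuclideanSpace ℝ (Fin n)) :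
    IsProbabilityMeasure (∑ i, ((n : ℝ≥0∞) + 1)⁻¹ • Measure.dirac (x i)) := by
  refine ⟨?_⟩
  simp only [Measure.finsetSum_apply, Measure.smul_apply, measure_univ, smul_eq_mul, mul_one,
    Finset.sum_const, Finset.card_univ, Fintype.card_fin, nsmul_eq_mul]
  push_cast
  exact ENNReal.mul_inv_cancel (by simp) (by finiteness)

/-- Of the (n+1)² ordered pairs of vertices, n(n+1) are distinct, and each of these contributes −c.
-/
theorem interactionEnergy_simplex (hα : α ≠ 0) (hβ : 0 < β) (hβα : β ≤ α)
    {x : Fin (n + 1) → EuclideanSpace ℝ (Fin n)} (hx : IsUnitSimplexVertices x) :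
    interactionEnergy (powerLawPotential α β)
        (∑ i, ((n : ℝ≥0∞) + 1)⁻¹ • Measure.dirac (x i)) =
      ((-((1 / β - 1 / α) * (n / (n + 1))) : ℝ) : EReal) := by
  have := isProbabilityMeasure_sum_dirac x
  have hcont : Continuous (powerLawPotential (n := n) α β) :=
    continuous_powerLawPotential (by linarith) hβ.le
  have hWij : ∀ i j, powerLawPotential α β (x i - x j) =
      if i = j then 0 else -(1 / β - 1 / α) := fun i j => by
    split_ifs with h
    · simp [h, powerLawPotential, Real.zero_rpow hα, Real.zero_rpow hβ.ne']
    · have : ‖x i - x j‖ = 1 := by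
        rw [← dist_eq_norm]
        rcases lt_or_gt_of_ne h with h | h
        · exact hx i j h
        · rw [dist_comm]; exact hx j i h
      simp [powerLawPotential, this]
  have hlint : ∀ f : ℝ → ℝ≥0∞, Measurable f →
      ∫⁻ p, f (powerLawPotential α β (p.1 - p.2))
        ∂((∑ i, ((n : ℝ≥0∞) + 1)⁻¹ • Measure.dirac (x i)).prod
          (∑ i, ((n : ℝ≥0∞) + 1)⁻¹ • Measure.dirac (x i))) =
      ∑ i, ((n : ℝ≥0∞) + 1)⁻¹ * ∑ j, ((n : ℝ≥0∞) + 1)⁻¹ *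
        f (powerLawPotential α β (x i - x j)) := fun f hf => by
    rw [lintegral_prod _ (by fun_prop)]
    simp only [lintegral_finsetSum_measure, lintegral_smul_measure, smul_eq_mul, lintegral_dirac]
  have hc : 0 ≤ 1 / β - 1 / α := sub_nonneg.2 (one_div_le_one_div_of_le hβ hβα)
  rw [interactionEnergy, hlint _ ENNReal.measurable_ofReal,
    hlint (fun t => ENNReal.ofReal (-t)) (by fun_prop)]
  simp only [hWij]
  set c := 1 / β - 1 / α
  have h1 : ∀ i j : Fin (n + 1), ENNReal.ofReal (if i = j then 0 else -c) = 0 := fun i j => by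
    split_ifs <;> simp [hc]
  have h2 : ∀ i j : Fin (n + 1), ENNReal.ofReal (-(if i = j then 0 else -c)) =
      ENNReal.ofReal (if i = j then 0 else c) := fun i j => by
    split_ifs <;> simp
  have hinv : ((n : ℝ≥0∞) + 1)⁻¹ = ENNReal.ofReal (((n : ℝ) + 1)⁻¹) := by
    rw [ENNReal.ofReal_inv_of_pos (by positivity), ENNReal.ofReal_add (by positivity) zero_le_one]
    simp
  have h3 : ∀ i j : Fin (n + 1), (0 : ℝ) ≤ if i = j then 0 else c := fun i j => by
    split_ifs <;> simp [hc]
  have hi : (0 : ℝ) ≤ ((n : ℝ) + 1)⁻¹ := by positivity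
  have h4 : ∑ i : Fin (n + 1), ((n : ℝ≥0∞) + 1)⁻¹ * ∑ j : Fin (n + 1), ((n : ℝ≥0∞) + 1)⁻¹ *
      ENNReal.ofReal (if i = j then 0 else c) =
      ENNReal.ofReal (∑ i : Fin (n + 1), ((n : ℝ) + 1)⁻¹ * ∑ j : Fin (n + 1), ((n : ℝ) + 1)⁻¹ *
        if i = j then 0 else c) := by
    rw [hinv, ENNReal.ofReal_sum_of_nonneg fun i _ =>
      mul_nonneg hi (Finset.sum_nonneg fun j _ => mul_nonneg hi (h3 i j))]
    refine Finset.sum_congr rfl fun i _ => ?_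
    rw [ENNReal.ofReal_mul hi, ENNReal.ofReal_sum_of_nonneg fun j _ => mul_nonneg hi (h3 i j)]
    simp only [ENNReal.ofReal_mul hi]
  have h5 : ∑ i : Fin (n + 1), ((n : ℝ) + 1)⁻¹ * ∑ j : Fin (n + 1), ((n : ℝ) + 1)⁻¹ *
      (if i = j then 0 else c) = c * (n / (n + 1)) := by
    have : ∀ i j : Fin (n + 1), (if i = j then 0 else c) = c - if i = j then c else 0 :=
      fun i j => by split_ifs <;> simp
    simp only [this, ← Finset.mul_sum, Finset.sum_sub_distrib, Finset.sum_ite_eq, Finset.mem_univ,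
      if_true, Finset.sum_const, Finset.card_univ, Fintype.card_fin, nsmul_eq_mul]
    push_cast
    field_simp
    ring
  simp only [h1, h2, h4, h5, mul_zero, Finset.sum_const_zero, EReal.coe_ennreal_zero, zero_sub]
  rw [EReal.coe_ennreal_ofReal, max_eq_left (by positivity), EReal.coe_neg]

end Energy

/-! ### The main theorem -/

theorem theoremT (n : ℕ) (β : ℝ) (hβ : 2 ≤ β) :
    ∃ A : ℝ, ∀ α : ℝ, β ≤ α → A ≤ α →
      ∀ μ : Measure (EuclideanSpace ℝ (Fin n)), IsProbabilityMeasure μ →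
        (IsEnergyMinimizer (powerLawPotential α β) μ ↔ IsUniformOnUnitSimplexVertices μ) := by
  -- Any threshold above both 4 and β would do.
  refine ⟨max 5 (β + 1), fun α hβα hA μ hμ => ?_⟩
  have hα : 4 < α := by linarith [le_max_left 5 (β + 1)]
  have hlt : β < α := by linarith [le_max_right 5 (β + 1)]
  constructor
  · rintro ⟨-, hmin⟩
    obtain ⟨x, hx⟩ := exists_isUnitSimplexVertices n
    have hle := hmin _ (isProbabilityMeasure_sum_dirac x)
    rw [interactionEnergy_simplex (by linarith) (by linarith) hβα hx] at hle
    obtain ⟨hge, huniq⟩ := powerLaw_energy_bound hβ hα hlt μ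
    exact huniq (hle.antisymm hge)
  · rintro ⟨x, hx, rfl⟩
    refine ⟨hμ, fun ν hν => ?_⟩
    rw [interactionEnergy_simplex (by linarith) (by linarith) hβα hx]
    exact (powerLaw_energy_bound hβ hα hlt ν).1
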